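/- Theorem 1.4. Let $\sigma=\{\sigma_i\mid i\in I\}$ be a partition of the set of all primes, and let all groups be finite. For an integer $n\ge 1$ let $\sigma(n)$ be the set of those $\sigma_i$ that contain a prime divisor of $n$, and let $\sigma(G)=\sigma(|G|)$. For a set $\pi$ of primes with complement $\pi'$, a $\pi$-group is a group all of whose order's prime divisors lie in $\pi$. A chief factor $H/K$ of $G$ is $\sigma$-central in $G$ if, for some $i$, both $H/K$ and $G/C_G(H/K)$ are $\sigma_i$-groups. The group $G$ is $\sigma$-soluble if every chief factor of $G$ is a $\sigma_i$-group for some $i$ (depending on the factor); $\sigma$-nilpotent if every chief factor of $G$ is $\sigma$-central in $G$; and $\{\sigma_i\}$-nilpotent if every chief factor $H/K$ of $G$ with $\sigma_i\in\sigma(H/K)$ is $\sigma$-central in $G$. Let $F_{\{\sigma_i\}}(G)$ be the largest normal $\{\sigma_i\}$-nilpotent subgroup of $G$ (the product of all normal $\{\sigma_i\}$-nilpotent subgroups). A group is $\mathfrak N_\sigma$-critical if it is not $\sigma$-nilpotent but all its proper subgroups are. For $G\neq 1$, the $\sigma$-Hawkes graph $\Gamma_{H\sigma}(G)$ and the $\sigma$-Vasil'ev–Murashko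 graph $\Gamma_{\mathfrak N_\sigma}(G)$ are the directed graphs with vertex set $\sigma(G)$ in which, respectively, $(\sigma_i,\sigma_j)$ is an edge if and only if $\sigma_j\in\sigma(G/F_{\{\sigma_i\}}(G))$; and $(\sigma_i,\sigma_j)$ is an edge if and only if for some $\mathfrak N_\sigma$-critical subgroup $H$ of $G$ we have $\sigma_i\in\sigma(H)$ and $\sigma_j\in\sigma(H/F_{\{\sigma_i\}}(H))$. A circuit is a closed directed walk of length at least $1$; in particular a loop is a circuit. Let $G\ne 1$ be a finite group. Then the following statements are equivalent: (1) $G$ has a series of normal subgroups $1=G_0<G_1<\cdots<G_t=G$ such that for every $k=1,\dots,t$ there is some $\sigma_i\in\sigma(G)$ for which $G_k/G_{k-1}$ is a $\sigma_i$-group and both $G_{k-1}$ and $G/G_k$ are $\sigma_i'$-groups; (2) $\Gamma_{H\sigma}(G)$ has no circuits; (3) $G$ is $\sigma$-soluble and $\Gamma_{\mathfrak N_\sigma}(G)$ has no circuits. -/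

import Mathlib

/-- `σ` is a partition of the set of all primes, indexed by `I`. -/
structure IsPrimePartition {I : Type*} (σ : I → Set ℕ) : Prop where
  disjoint : ∀ i j, i ≠ j → Disjoint (σ i) (σ j)
  cover : ⋃ i, σ i = {p : ℕ | p.Prime}

/-- `n` is a `π`-number: all prime divisors of `n` lie in `π`. A finite group (or section) is a
`π`-group when its order is a `π`-number. For `π'`-numbers we use `IsPiNumber πᶜ`. -/
def IsPiNumber (π : Set ℕ) (n : ℕ) : Prop :=
  ∀ p : ℕ, p.Prime → p ∣ n → p ∈ π

/-- `σ(n)`: the set of (indices of) blocks of `σ` that contain a prime divisor of `n`. -/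
def sigmaOf {I : Type*} (σ : I → Set ℕ) (n : ℕ) : Set I :=
  {i | ∃ p ∈ σ i, p.Prime ∧ p ∣ n}

/-- `H/K` is a chief factor of `G`, for normal subgroups `K`, `H` of `G`: `K < H` and no normal
subgroup of `G` lies strictly in between. -/
def IsChiefFactor {G : Type*} [Group G] (H K : Subgroup G) : Prop :=
  H.Normal ∧ K.Normal ∧ K < H ∧ ∀ L : Subgroup G, L.Normal → K ≤ L → L ≤ H → L = K ∨ L = H

/-- `C_G(H/K)`, the set of `g ∈ G` that centralize `HK/K` in `G/K`. -/
def factorCentralizer {G : Type*} [Group G] (H K : Subgroup G) [K.Normal] : Subgroup G :=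
  (Subgroup.centralizer ((H.map (QuotientGroup.mk' K) : Subgroup (G ⧸ K)) : Set (G ⧸ K))).comap
    (QuotientGroup.mk' K)

/-- The factor `H/K` is `π`-central in `G`: `H/K` (of order `K.relIndex H`) and `G/C_G(H/K)` are
`π`-groups. -/
def IsPiCentral {G : Type*} [Group G] (π : Set ℕ) (H K : Subgroup G) [K.Normal] : Prop :=
  IsPiNumber π (K.relIndex H) ∧ IsPiNumber π (factorCentralizer H K).index

/-- The factor `H/K` is `σ`-central in `G`: it is `σ i`-central for some `i`. -/
def IsSigmaCentral {G I : Type*} [Group G] (σ : I → Set ℕ) (H K : Subgroup G) [K.Normal] : Prop :=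
  ∃ i, IsPiCentral (σ i) H K

/-- `G` is `σ`-soluble: every chief factor is a `σ i`-group for some `i`. -/
def IsSigmaSoluble {I : Type*} (σ : I → Set ℕ) (G : Type*) [Group G] : Prop :=
  ∀ H K : Subgroup G, IsChiefFactor H K → ∃ i, IsPiNumber (σ i) (K.relIndex H)

/-- `G` is `σ`-nilpotent: every chief factor is `σ`-central. -/
def IsSigmaNilpotent {I : Type*} (σ : I → Set ℕ) (G : Type*) [Group G] : Prop :=
  ∀ (H K : Subgroup G) [K.Normal], IsChiefFactor H K → IsSigmaCentral σ H K

/-- `G` is `{σ i}`-nilpotent: every chief factor whose order is divisible by a prime of `σ i` is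
`σ`-central. -/
def IsBlockNilpotent {I : Type*} (σ : I → Set ℕ) (i : I) (G : Type*) [Group G] : Prop :=
  ∀ (H K : Subgroup G) [K.Normal], IsChiefFactor H K →
    i ∈ sigmaOf σ (K.relIndex H) → IsSigmaCentral σ H K

/-- `F_{σ i}(G)`: the largest normal `{σ i}`-nilpotent subgroup of `G`, given as the subgroup
generated by (equivalently, the product of) all normal `{σ i}`-nilpotent subgroups. -/
def blockFitting {I : Type*} (σ : I → Set ℕ) (i : I) (G : Type*) [Group G] : Subgroup G :=
  sSup {N : Subgroup G | N.Normal ∧ IsBlockNilpotent σ i N}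

/-- `G` is `𝔑_σ`-critical: it is not `σ`-nilpotent but all its proper subgroups are. -/
def IsSigmaCritical {I : Type*} (σ : I → Set ℕ) (G : Type*) [Group G] : Prop :=
  ¬ IsSigmaNilpotent σ G ∧ ∀ H : Subgroup G, H < ⊤ → IsSigmaNilpotent σ H

/-- The `σ`-Hawkes graph of `G`, a directed graph (loops allowed) with vertex set `σ(G)`. -/
def sigmaHawkesGraph {I : Type*} (σ : I → Set ℕ) (G : Type*) [Group G] :
    Digraph (sigmaOf σ (Nat.card G)) where
  Adj i j := j.1 ∈ sigmaOf σ (blockFitting σ i.1 G).index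

/-- The `σ`-Vasil'ev–Murashko graph of `G`, a directed graph (loops allowed) with vertex
set `σ(G)`. -/
def sigmaVasilevMurashkoGraph {I : Type*} (σ : I → Set ℕ) (G : Type*) [Group G] :
    Digraph (sigmaOf σ (Nat.card G)) where
  Adj i j := ∃ H : Subgroup G, IsSigmaCritical σ H ∧ i.1 ∈ sigmaOf σ (Nat.card H) ∧
    j.1 ∈ sigmaOf σ (blockFitting σ i.1 H).index

/-- A directed graph has no circuits: no directed walk of length at least one returns to its
starting vertex. In particular there are no loops. -/
def HasNoCircuits {V : Type*} (Γ : Digraph V) : Prop :=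
  ∀ v : V, ¬ Relation.TransGen Γ.Adj v v

/-- `G` has a normal series `1 = G_0 < G_1 < ⋯ < G_t = G` such that for each `k < t` there is
`σ i ∈ σ(G)` for which `G_{k+1}/G_k` is a `σ i`-group while `G_k` and `G/G_{k+1}` are
`(σ i)'`-groups. -/
def HasSigmaTower {I : Type*} (σ : I → Set ℕ) (G : Type*) [Group G] : Prop :=
  ∃ (t : ℕ) (N : Fin (t + 1) → Subgroup G),
    N 0 = ⊥ ∧ N (Fin.last t) = ⊤ ∧ StrictMono N ∧ (∀ k, (N k).Normal) ∧
    ∀ k : Fin t, ∃ i ∈ sigmaOf σ (Nat.card G),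
      IsPiNumber (σ i) ((N k.castSucc).relIndex (N k.succ)) ∧
      IsPiNumber (σ i)ᶜ (Nat.card (N k.castSucc)) ∧
      IsPiNumber (σ i)ᶜ (N k.succ).index

/-!
A `{σ i}`-nilpotent group is a group with a normal `σ i`-complement
(`isBlockNilpotent_iff`), so `F_{σ i}(G)` is the largest normal subgroup of `G` with a normal
`σ i`-complement, and `F_{σ i}(G) ⊓ H ≤ F_{σ i}(H)` for every subgroup `H`. Hence every edge of the
`σ`-Vasil'ev–Murashko graph is an edge of the `σ`-Hawkes graph.

In a tower, the term with top factor a `σ i`-group lies in `F_{σ i}(G)`, so that the edges of the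
`σ`-Hawkes graph lead from blocks of lower factors to blocks of higher factors, and there are no
circuits (`HasSigmaTower.hasNoCircuits`). Each chief factor is a section of one factor of the
tower, so `G` is `σ`-soluble.

Conversely, let `Γ` be either graph and suppose that it has no circuits. It is enough to find, for
every set `S` of vertices closed under predecessors in `Γ`, a normal Hall subgroup for the primes
in the blocks of `S`: listing the vertices so that all edges point forward, the normal Hall
subgroups for the initial segments form a tower (`hasSigmaTower_of_hasNoCircuits`).

* For the `σ`-Hawkes graph, this subgroup is the intersection of the largest normal
  `(σ j)'`-subgroups for `j ∉ S` (`hasNormalHall_of_sigmaHawkesGraph`).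
* For the `σ`-Vasil'ev–Murashko graph, let `π` be the set of primes in the blocks of `S`. A
  `p`-element, `p ∈ π`, that normalizes a `q`-subgroup, `q ∉ π`, centralizes it, because otherwise
  the two generate a group with a critical subgroup that gives an edge into `S` from outside
  (`piElementsCentralize_of_sigmaVasilevMurashkoGraph`). By the Frattini argument this property
  passes to quotients. Modulo the largest normal `π`-subgroup, a normal `π'`-subgroup `M` is then
  centralized by all `π`-elements. If `M` is the largest one and not the whole group, a chief
  factor `N/M` is a `π`-group by `σ`-solubility, and the Schur–Zassenhaus theorem in the
  centralizer of `M` in `N` yields a nontrivial normal `π`-subgroup, a contradiction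
  (`PiElementsCentralize.hasNormalHall`).
-/

/-! ### `π`-numbers -/

lemma IsPiNumber.of_dvd {π : Set ℕ} {m n : ℕ} (hn : IsPiNumber π n) (h : m ∣ n) :
    IsPiNumber π m :=
  fun p hp hpm => hn p hp (hpm.trans h)

lemma IsPiNumber.mul {π : Set ℕ} {m n : ℕ} (hm : IsPiNumber π m) (hn : IsPiNumber π n) :
    IsPiNumber π (m * n) :=
  fun p hp h => (hp.dvd_mul.1 h).elim (hm p hp) (hn p hp)

lemma IsPiNumber.mono {π ρ : Set ℕ} {n : ℕ} (h : IsPiNumber π n) (hπ : π ⊆ ρ) :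
    IsPiNumber ρ n :=
  fun p hp hpn => hπ (h p hp hpn)

lemma isPiNumber_one (π : Set ℕ) : IsPiNumber π 1 :=
  fun _ hp h => absurd h hp.not_dvd_one

lemma IsPiNumber.coprime {π : Set ℕ} {m n : ℕ} (hm : IsPiNumber π m) (hn : IsPiNumber πᶜ n) :
    Nat.Coprime m n :=
  Nat.Coprime.symm (Nat.coprime_of_dvd fun p hp hpn hpm => hn p hp hpn (hm p hp hpm))

lemma IsPiNumber.eq_one {π : Set ℕ} {n : ℕ} (h : IsPiNumber π n) (h' : IsPiNumber πᶜ n) :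
    n = 1 :=
  (Nat.coprime_self n).1 (h.coprime h')

lemma isPiNumber_prime_pow {π : Set ℕ} {p : ℕ} (hp : p.Prime) (hpπ : p ∈ π) (k : ℕ) :
    IsPiNumber π (p ^ k) := fun _ hq hqp =>
  (Nat.prime_dvd_prime_iff_eq hq hp).1 (hq.dvd_of_dvd_pow hqp) ▸ hpπ

/-! ### Normal Hall subgroups -/

/-- `G` has a normal Hall `π`-subgroup: a normal `π`-subgroup whose index is a `π'`-number. -/
def HasNormalHall (π : Set ℕ) (G : Type*) [Group G] : Prop :=
  ∃ N : Subgroup G, N.Normal ∧ IsPiNumber π (Nat.card N) ∧ IsPiNumber πᶜ N.index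

section Hall

variable {G : Type*} [Group G]

/-- A normal subgroup of `π'`-index contains all `π`-elements. -/
lemma mem_of_isPiNumber_orderOf {π : Set ℕ} {N : Subgroup G} [N.Normal]
    (hN : IsPiNumber πᶜ N.index) {x : G} (hx : IsPiNumber π (orderOf x)) : x ∈ N := by
  have h1 : orderOf (QuotientGroup.mk' N x) ∣ orderOf x := orderOf_map_dvd _ x
  have h2 : orderOf (QuotientGroup.mk' N x) ∣ N.index := orderOf_dvd_natCard _
  have h3 := (hx.of_dvd h1).eq_one (hN.of_dvd h2)
  rw [orderOf_eq_one_iff] at h3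
  exact (QuotientGroup.eq_one_iff x).1 h3

lemma isPiNumber_orderOf_of_mem {π : Set ℕ} {N : Subgroup G}
    (hN : IsPiNumber π (Nat.card N)) {x : G} (hx : x ∈ N) : IsPiNumber π (orderOf x) :=
  hN.of_dvd (Subgroup.orderOf_dvd_natCard _ hx)

/-- A `π`-subgroup lies in every normal subgroup of `π'`-index. -/
lemma le_of_isPiNumber {π : Set ℕ} {M N : Subgroup G} [N.Normal]
    (hM : IsPiNumber π (Nat.card M)) (hN : IsPiNumber πᶜ N.index) : M ≤ N :=
  fun _ hx => mem_of_isPiNumber_orderOf hN (isPiNumber_orderOf_of_mem hM hx)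

lemma HasNormalHall.of_mulEquiv {π : Set ℕ} {G' : Type*} [Group G'] (e : G ≃* G')
    (h : HasNormalHall π G) : HasNormalHall π G' := by
  obtain ⟨N, hN, h1, h2⟩ := h
  refine ⟨N.map e.toMonoidHom, hN.map _ e.surjective, ?_, ?_⟩
  · rwa [Nat.card_congr (N.equivMapOfInjective e.toMonoidHom e.injective).toEquiv.symm]
  · rwa [Subgroup.index_map_of_bijective e.bijective]

/-- A normal Hall subgroup of a normal subgroup `A` of `G` is normal in `G`. -/
lemma HasNormalHall.exists_normal {π : Set ℕ} {A : Subgroup G} (hA : A.Normal)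
    (h : HasNormalHall π A) :
    ∃ L : Subgroup G, L.Normal ∧ L ≤ A ∧ IsPiNumber π (Nat.card L) ∧
      IsPiNumber πᶜ (L.relIndex A) := by
  obtain ⟨N, hN, h1, h2⟩ := h
  have hc : Nat.card (N.map A.subtype) = Nat.card N :=
    Nat.card_congr (N.equivMapOfInjective A.subtype A.subtype_injective).toEquiv.symm
  refine ⟨N.map A.subtype, ⟨?_⟩, Subgroup.map_subtype_le N, by rwa [hc], ?_⟩
  · rintro _ ⟨x, hx, rfl⟩ g
    refine ⟨⟨g * x * g⁻¹, hA.conj_mem _ x.2 g⟩, mem_of_isPiNumber_orderOf h2 ?_, rfl⟩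
    rw [Subgroup.orderOf_mk]
    have : g * (x : G) * g⁻¹ = MulAut.conj g x := rfl
    rw [this, MulEquiv.orderOf_eq, Subgroup.orderOf_coe]
    exact isPiNumber_orderOf_of_mem h1 hx
  · rwa [Subgroup.relIndex, Subgroup.subgroupOf,
      Subgroup.comap_map_eq_self_of_injective A.subtype_injective]

lemma hasNormalHall_of_relIndex {π : Set ℕ} {A L : Subgroup G} (hL : L.Normal) (hLA : L ≤ A)
    (h1 : IsPiNumber π (Nat.card L)) (h2 : IsPiNumber πᶜ (L.relIndex A)) : HasNormalHall π A :=
  ⟨L.subgroupOf A, hL.subgroupOf A, by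
    rwa [Nat.card_congr (Subgroup.subgroupOfEquivOfLe hLA).toEquiv], h2⟩

/-- The intersection of a normal Hall subgroup of `A` with `B ≤ A` is a normal Hall subgroup of `B`. -/
lemma hasNormalHall_of_le {π : Set ℕ} {A B L : Subgroup G} (hL : L.Normal) (hBA : B ≤ A)
    (h1 : IsPiNumber π (Nat.card L)) (h2 : IsPiNumber πᶜ (L.relIndex A)) : HasNormalHall π B := by
  refine ⟨L.subgroupOf B, hL.subgroupOf B, h1.of_dvd ?_, h2.of_dvd ?_⟩
  · exact Subgroup.card_comap_dvd_of_injective L B.subtype B.subtype_injective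
  · change L.relIndex B ∣ _
    have := Subgroup.relIndex_dvd_index_of_normal (L.subgroupOf A) (B.subgroupOf A)
    rwa [Subgroup.relIndex_subgroupOf hBA] at this

lemma isPiNumber_card_sup {π : Set ℕ} {M N : Subgroup G} [M.Normal]
    (hM : IsPiNumber π (Nat.card M)) (hN : IsPiNumber π (Nat.card N)) :
    IsPiNumber π (Nat.card (N ⊔ M : Subgroup G)) := by
  rw [← Subgroup.relIndex_bot_left, ← Subgroup.relIndex_mul_relIndex ⊥ M _ bot_le le_sup_right,
    Subgroup.relIndex_sup_right, Subgroup.relIndex_bot_left]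
  exact hM.mul (hN.of_dvd (Subgroup.relIndex_dvd_card _ _))

/-- The `π`-residual: there is a smallest normal subgroup of `π`-index. -/
lemma exists_least_normal_isPiNumber_index [Finite G] (π : Set ℕ) :
    ∃ A : Subgroup G, A.Normal ∧ IsPiNumber π A.index ∧
      ∀ B : Subgroup G, B.Normal → IsPiNumber π B.index → A ≤ B := by
  obtain ⟨A, hA⟩ := (Set.toFinite {A : Subgroup G | A.Normal ∧ IsPiNumber π A.index})
    |>.exists_minimal ⟨⊤, inferInstance, by simpa using isPiNumber_one _⟩
  obtain ⟨⟨hAn, hAi⟩, -⟩ := id hA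
  refine ⟨A, hAn, hAi, fun B hB hBi => ?_⟩
  refine (hA.le_of_le (y := A ⊓ B) ⟨inferInstance, ?_⟩ inf_le_left).trans inf_le_right
  rw [← Subgroup.relIndex_mul_index (inf_le_left : A ⊓ B ≤ A), Subgroup.inf_relIndex_left]
  exact (hBi.of_dvd (Subgroup.relIndex_dvd_index_of_normal _ _)).mul hAi

/-- The complement of a central Hall subgroup `H` of a normal subgroup `A` of `G` can be taken
normal in `G`: it consists of the elements of `A` of order dividing `|A : H|`. -/
lemma exists_normal_complement_of_central [Finite G] {H A : Subgroup G} (hH : H.Normal)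
    (hA : A.Normal) (hHA : H ≤ A) (hc : A ≤ Subgroup.centralizer H)
    (hco : Nat.Coprime (Nat.card H) (H.relIndex A)) :
    ∃ L : Subgroup G, L.Normal ∧ L ≤ A ∧ Nat.card L = H.relIndex A ∧
      L.relIndex A = Nat.card H := by
  have : (H.subgroupOf A).Normal := hH.subgroupOf A
  have hcard : Nat.card (H.subgroupOf A) = Nat.card H :=
    Nat.card_congr (Subgroup.subgroupOfEquivOfLe hHA).toEquiv
  obtain ⟨L, hL⟩ := Subgroup.exists_right_complement'_of_coprime
    (N := H.subgroupOf A) (by rwa [hcard])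
  have hLc : Nat.card L = H.relIndex A := hL.card_right
  have hcL : Nat.card (L.map A.subtype) = Nat.card L :=
    Nat.card_congr (L.equivMapOfInjective A.subtype A.subtype_injective).toEquiv.symm
  have key : ∀ x : A, x ^ Nat.card L = 1 → x ∈ L := by
    intro x hx
    obtain ⟨⟨h, l⟩, rfl⟩ := hL.2 x
    have hcomm : Commute (h : A) l := Subtype.ext (hc (l : A).2 _ h.2)
    have hl : (l : A) ^ Nat.card L = 1 := by
      rw [← Subgroup.coe_pow, pow_card_eq_one', Subgroup.coe_one]
    have hh : (h : A) ^ Nat.card L = 1 := by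
      simpa [hcomm.mul_pow, hl] using hx
    have h1 : orderOf (h : A) ∣ Nat.card L := orderOf_dvd_of_pow_eq_one hh
    have h2 : orderOf (h : A) ∣ Nat.card H := hcard ▸ Subgroup.orderOf_dvd_natCard _ h.2
    have h3 : (h : A) = 1 := by
      rw [← orderOf_eq_one_iff]
      exact Nat.eq_one_of_dvd_coprimes hco h2 (hLc ▸ h1)
    simp [h3]
  refine ⟨L.map A.subtype, ⟨?_⟩, Subgroup.map_subtype_le L, by rw [hcL, hLc], ?_⟩
  · rintro _ ⟨x, hx, rfl⟩ g
    refine ⟨⟨g * x * g⁻¹, hA.conj_mem _ x.2 g⟩, key _ ?_, rfl⟩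
    have hx1 : (x : G) ^ Nat.card L = 1 := by
      have : (⟨x, hx⟩ : L) ^ Nat.card L = 1 := pow_card_eq_one'
      exact congrArg (fun y : L => ((y : A) : G)) this
    apply Subtype.ext
    simp [conj_pow, hx1]
  · rw [Subgroup.relIndex, Subgroup.subgroupOf,
      Subgroup.comap_map_eq_self_of_injective A.subtype_injective, ← hcard]
    exact hL.symm.card_right.symm

end Hall

/-! ### Block-nilpotent groups -/

section Block

variable {G I : Type*} [Group G]

lemma IsPrimePartition.eq_of_mem {σ : I → Set ℕ} (hσ : IsPrimePartition σ) {i j : I} {p : ℕ}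
    (hi : p ∈ σ i) (hj : p ∈ σ j) : i = j := by
  by_contra h
  exact Set.disjoint_left.1 (hσ.disjoint i j h) hi hj

lemma IsPrimePartition.exists_mem {σ : I → Set ℕ} (hσ : IsPrimePartition σ) {p : ℕ}
    (hp : p.Prime) : ∃ i, p ∈ σ i := by
  have : p ∈ ⋃ i, σ i := hσ.cover ▸ hp
  simpa using this

lemma isPiNumber_compl_of_notMem {σ : I → Set ℕ} {i : I} {n : ℕ} (h : i ∉ sigmaOf σ n) :
    IsPiNumber (σ i)ᶜ n :=
  fun p hp hpn hpi => h ⟨p, hpi, hp, hpn⟩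

lemma IsPiNumber.notMem_sigmaOf {σ : I → Set ℕ} {i : I} {n : ℕ} (h : IsPiNumber (σ i)ᶜ n) :
    i ∉ sigmaOf σ n :=
  fun ⟨p, hpi, hp, hpn⟩ => h p hp hpn hpi

lemma sigmaOf_mono {σ : I → Set ℕ} {m n : ℕ} (h : m ∣ n) : sigmaOf σ m ⊆ sigmaOf σ n :=
  fun _ ⟨p, hpi, hp, hpm⟩ => ⟨p, hpi, hp, hpm.trans h⟩

lemma mem_factorCentralizer {H K : Subgroup G} [K.Normal] {g : G} :
    g ∈ factorCentralizer H K ↔ ∀ h ∈ H, ((h : G) : G ⧸ K) * g = g * h := by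
  simp [factorCentralizer, Subgroup.mem_centralizer_iff]

lemma normal_factorCentralizer {H K : Subgroup G} (hH : H.Normal) [K.Normal] :
    (factorCentralizer H K).Normal := by
  have : (H.map (QuotientGroup.mk' K)).Normal :=
    hH.map _ (QuotientGroup.mk'_surjective K)
  unfold factorCentralizer
  infer_instance

/-- A group with a normal `σ i`-complement is `{σ i}`-nilpotent: the complement `M` centralizes
every chief factor `H/K` with `H ⊓ M ≤ K`, and covers all the others. -/
lemma isBlockNilpotent_of_hasNormalHall {σ : I → Set ℕ} {i : I}
    (h : HasNormalHall (σ i)ᶜ G) : IsBlockNilpotent σ i G := by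
  obtain ⟨M, hM, h1, h2⟩ := h
  rw [compl_compl] at h2
  rintro H K hK ⟨hH, -, hKH, hchief⟩ hi
  rcases hchief (K ⊔ H ⊓ M) inferInstance le_sup_left (sup_le hKH.le inf_le_left) with h | h
  · have hHM : H ⊓ M ≤ K := sup_eq_left.1 h
    refine ⟨i, h2.of_dvd ?_, h2.of_dvd (Subgroup.index_dvd_of_le ?_)⟩
    · refine (Subgroup.relIndex_dvd_of_le_left H hHM).trans ?_
      rw [Subgroup.inf_relIndex_left]
      exact Subgroup.relIndex_dvd_index_of_normal M H
    · intro m hm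
      rw [mem_factorCentralizer]
      intro x hx
      rw [← QuotientGroup.mk_mul, ← QuotientGroup.mk_mul, QuotientGroup.eq]
      apply hHM
      have e : (x * m)⁻¹ * (m * x) = m⁻¹ * (x⁻¹ * m * x) := by group
      have e' : (x * m)⁻¹ * (m * x) = (m⁻¹ * x⁻¹ * m) * x := by group
      refine ⟨?_, ?_⟩
      · rw [e']
        refine H.mul_mem ?_ hx
        simpa using hH.conj_mem _ (H.inv_mem hx) m⁻¹
      · rw [e]
        refine M.mul_mem (M.inv_mem hm) ?_
        simpa using hM.conj_mem _ hm x⁻¹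
  · refine absurd hi (IsPiNumber.notMem_sigmaOf (h1.of_dvd ?_))
    rw [← h, sup_comm, Subgroup.relIndex_sup_right]
    exact (Subgroup.relIndex_dvd_card _ _).trans (Subgroup.card_dvd_of_le inf_le_right)

lemma exists_isChiefFactor_top [Finite G] {H : Subgroup G} (hH : H.Normal) (h : H ≠ ⊥) :
    ∃ K, IsChiefFactor H K := by
  obtain ⟨K, hK⟩ := (Set.toFinite {K : Subgroup G | K.Normal ∧ K < H}).exists_maximal
    ⟨⊥, inferInstance, bot_lt_iff_ne_bot.2 h⟩
  refine ⟨K, hH, hK.prop.1, hK.prop.2, fun L hL hKL hLH => ?_⟩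
  rcases hLH.eq_or_lt with h | h
  · exact .inr h
  · exact .inl (le_antisymm (hK.le_of_ge ⟨hL, h⟩ hKL) hKL)

lemma exists_isChiefFactor_bot [Finite G] {M : Subgroup G} (hM : M.Normal) (h : M ≠ ⊤) :
    ∃ N, IsChiefFactor N M := by
  obtain ⟨N, hN⟩ := (Set.toFinite {N : Subgroup G | N.Normal ∧ M < N}).exists_minimal
    ⟨⊤, inferInstance, lt_top_iff_ne_top.2 h⟩
  refine ⟨N, hN.prop.1, hM, hN.prop.2, fun L hL hML hLN => ?_⟩
  rcases hML.eq_or_lt with h | h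
  · exact .inl h.symm
  · exact .inr (le_antisymm hLN (hN.le_of_le ⟨hL, h⟩ hLN))

/-- A `{σ i}`-nilpotent group has a normal `σ i`-complement. If the smallest normal subgroup `A`
of `σ i`-index were not a `(σ i)'`-group, the topmost chief factor `H/K` below `A` whose order is
not a `(σ i)'`-number would be centralized by `A` and split off from `A/K`, giving a smaller
normal subgroup of `σ i`-index. -/
lemma IsBlockNilpotent.hasNormalHall [Finite G] {σ : I → Set ℕ} (hσ : IsPrimePartition σ) {i : I}
    (h : IsBlockNilpotent σ i G) : HasNormalHall (σ i)ᶜ G := by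
  obtain ⟨A, hAn, hAi, hAle⟩ := exists_least_normal_isPiNumber_index (G := G) (σ i)
  refine ⟨A, hAn, ?_, by rwa [compl_compl]⟩
  obtain ⟨H, hH⟩ := (Set.toFinite {H : Subgroup G | H.Normal ∧ H ≤ A ∧
    IsPiNumber (σ i)ᶜ (H.relIndex A)}).exists_minimal
      ⟨A, hAn, le_rfl, by simpa using isPiNumber_one _⟩
  obtain ⟨⟨hHn, hHA, hHi⟩, -⟩ := id hH
  rcases eq_or_ne H ⊥ with rfl | hbot
  · rwa [Subgroup.relIndex_bot_left] at hHi
  exfalso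
  obtain ⟨K, hHK⟩ := exists_isChiefFactor_top hHn hbot
  obtain ⟨-, hK, hlt, -⟩ := id hHK
  have hi : i ∈ sigmaOf σ (K.relIndex H) := by
    by_contra hcon
    refine hlt.not_ge (hH.le_of_le ⟨hK, hlt.le.trans hHA, ?_⟩ hlt.le)
    rw [← Subgroup.relIndex_mul_relIndex K H A hlt.le hHA]
    exact (isPiNumber_compl_of_notMem hcon).mul hHi
  obtain ⟨j, hj1, hj2⟩ := h H K hHK hi
  obtain rfl : i = j := by
    obtain ⟨p, hpi, hp, hpd⟩ := hi
    exact hσ.eq_of_mem hpi (hj1 p hp hpd)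
  have hAC := hAle _ (normal_factorCentralizer hHn) hj2
  have hsurj := QuotientGroup.mk'_surjective K
  have hcardH : Nat.card (H.map (QuotientGroup.mk' K)) = K.relIndex H := by
    rw [← Subgroup.relIndex_ker, QuotientGroup.ker_mk']
  have hrel : (H.map (QuotientGroup.mk' K)).relIndex (A.map (QuotientGroup.mk' K)) =
      H.relIndex A := by
    rw [Subgroup.relIndex_map_map, QuotientGroup.ker_mk', sup_eq_left.2 hlt.le,
      sup_eq_left.2 (hlt.le.trans hHA)]
  obtain ⟨L, hLn, hLA, -, hLi⟩ := exists_normal_complement_of_central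
    (H := H.map (QuotientGroup.mk' K)) (A := A.map (QuotientGroup.mk' K))
    (hHn.map _ hsurj) (hAn.map _ hsurj) (Subgroup.map_mono hHA)
    (Subgroup.map_le_iff_le_comap.2 hAC) (by rw [hcardH, hrel]; exact hj1.coprime hHi)
  have hLA' : L.comap (QuotientGroup.mk' K) ≤ A := by
    refine (Subgroup.comap_mono hLA).trans ?_
    rw [Subgroup.comap_map_eq, QuotientGroup.ker_mk', sup_eq_left.2 (hlt.le.trans hHA)]
  have hLi' : (L.comap (QuotientGroup.mk' K)).relIndex A = K.relIndex H := by
    rw [Subgroup.relIndex_comap, hLi, hcardH]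
  have hle := hAle (L.comap (QuotientGroup.mk' K)) inferInstance (by
    rw [← Subgroup.relIndex_mul_index hLA', hLi']
    exact hj1.mul hAi)
  rw [Subgroup.relIndex_eq_one.2 hle] at hLi'
  exact hlt.not_ge (Subgroup.relIndex_eq_one.1 hLi'.symm)

lemma isBlockNilpotent_iff [Finite G] {σ : I → Set ℕ} (hσ : IsPrimePartition σ) {i : I} :
    IsBlockNilpotent σ i G ↔ HasNormalHall (σ i)ᶜ G :=
  ⟨fun h => h.hasNormalHall hσ, isBlockNilpotent_of_hasNormalHall⟩

/-- Since chief factors are nontrivial, a group is `σ`-nilpotent if and only if it has a normal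
`σ i`-complement for each `i`. -/
lemma isSigmaNilpotent_iff [Finite G] {σ : I → Set ℕ} (hσ : IsPrimePartition σ) :
    IsSigmaNilpotent σ G ↔ ∀ i, HasNormalHall (σ i)ᶜ G := by
  simp_rw [← isBlockNilpotent_iff hσ]
  refine ⟨fun h i H K hK hHK _ => h H K hHK, fun h H K hK hHK => ?_⟩
  have h1 : K.relIndex H ≠ 1 := fun h => hHK.2.2.1.not_ge (Subgroup.relIndex_eq_one.1 h)
  obtain ⟨p, hp, hpd⟩ := Nat.exists_prime_and_dvd h1
  obtain ⟨i, hi⟩ := hσ.exists_mem hp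
  exact h i H K hHK ⟨p, hi, hp, hpd⟩

/-- The structure of `F_{σ i}(G)`: it has a normal `σ i`-complement, which is normal in `G`, and
it contains every normal subgroup of `G` that has one. -/
lemma blockFitting_spec [Finite G] {σ : I → Set ℕ} (hσ : IsPrimePartition σ) (i : I) :
    (blockFitting σ i G).Normal ∧ HasNormalHall (σ i)ᶜ (blockFitting σ i G) ∧
      ∀ N : Subgroup G, N.Normal → HasNormalHall (σ i)ᶜ N → N ≤ blockFitting σ i G := by
  obtain ⟨M, hM⟩ := (Set.toFinite {M : Subgroup G | M.Normal ∧ IsPiNumber (σ i)ᶜ (Nat.card M)})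
    |>.exists_maximal ⟨⊥, inferInstance, by simpa using isPiNumber_one _⟩
  obtain ⟨⟨hMn, hMc⟩, -⟩ := id hM
  obtain ⟨N, hN⟩ := (Set.toFinite {N : Subgroup G | N.Normal ∧ M ≤ N ∧
    IsPiNumber (σ i) (M.relIndex N)}).exists_maximal
      ⟨M, hMn, le_rfl, by simpa using isPiNumber_one _⟩
  obtain ⟨⟨hNn, hMN, hNi⟩, -⟩ := id hN
  have hall : HasNormalHall (σ i)ᶜ N :=
    hasNormalHall_of_relIndex hMn hMN hMc (by rwa [compl_compl])
  have hmax : ∀ N' : Subgroup G, N'.Normal → HasNormalHall (σ i)ᶜ N' → N' ≤ N := by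
    intro N' hN' h
    obtain ⟨M', hM', hMN', hc, hi⟩ := h.exists_normal hN'
    rw [compl_compl] at hi
    have hM'M : M' ≤ M := le_sup_left.trans
      (hM.le_of_ge (y := M' ⊔ M) ⟨inferInstance, isPiNumber_card_sup hMc hc⟩ le_sup_right)
    refine le_sup_left.trans (hN.le_of_ge (y := N' ⊔ N)
      ⟨inferInstance, hMN.trans le_sup_right, ?_⟩ le_sup_right)
    rw [← Subgroup.relIndex_mul_relIndex M N _ hMN le_sup_right, Subgroup.relIndex_sup_right]
    exact hNi.mul (hi.of_dvd (Subgroup.relIndex_dvd_of_le_left _ (hM'M.trans hMN)))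
  have heq : blockFitting σ i G = N := by
    refine le_antisymm (sSup_le fun N' h => hmax N' h.1 ((isBlockNilpotent_iff hσ).1 h.2))
      (le_sSup ⟨hNn, isBlockNilpotent_of_hasNormalHall hall⟩)
  rw [heq]
  exact ⟨hNn, hall, hmax⟩

lemma normal_blockFitting [Finite G] {σ : I → Set ℕ} (hσ : IsPrimePartition σ) (i : I) :
    (blockFitting σ i G).Normal := (blockFitting_spec hσ i).1

lemma hasNormalHall_blockFitting [Finite G] {σ : I → Set ℕ} (hσ : IsPrimePartition σ) (i : I) :
    HasNormalHall (σ i)ᶜ (blockFitting σ i G) := (blockFitting_spec hσ i).2.1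

lemma le_blockFitting [Finite G] {σ : I → Set ℕ} (hσ : IsPrimePartition σ) {i : I}
    {N : Subgroup G} (hN : N.Normal) (h : HasNormalHall (σ i)ᶜ N) : N ≤ blockFitting σ i G :=
  (blockFitting_spec hσ i).2.2 N hN h

/-- The index of `F_{σ i}` in a subgroup divides its index in the group, because
`F_{σ i}(G) ⊓ H ≤ F_{σ i}(H)`. -/
lemma index_blockFitting_dvd [Finite G] {σ : I → Set ℕ} (hσ : IsPrimePartition σ) (i : I)
    (H : Subgroup G) : (blockFitting σ i H).index ∣ (blockFitting σ i G).index := by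
  have hF := normal_blockFitting (G := G) hσ i
  obtain ⟨L, hL, hLF, h1, h2⟩ := (hasNormalHall_blockFitting hσ i).exists_normal hF
  have h3 : HasNormalHall (σ i)ᶜ (blockFitting σ i G ⊓ H : Subgroup G) :=
    hasNormalHall_of_le hL inf_le_left h1 h2
  have e : (blockFitting σ i G ⊓ H : Subgroup G) ≃* (blockFitting σ i G).subgroupOf H := by
    rw [← Subgroup.inf_subgroupOf_right]
    exact (Subgroup.subgroupOfEquivOfLe inf_le_right).symm
  exact (Subgroup.index_dvd_of_le (le_blockFitting hσ (hF.subgroupOf H) (h3.of_mulEquiv e))).trans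
    (Subgroup.relIndex_dvd_index_of_normal _ H)

/-- The edges of the `σ`-Vasil'ev–Murashko graph are edges of the `σ`-Hawkes graph. -/
lemma sigmaHawkesGraph_adj_of_sigmaVasilevMurashkoGraph_adj [Finite G] {σ : I → Set ℕ}
    (hσ : IsPrimePartition σ) {v w : sigmaOf σ (Nat.card G)}
    (h : (sigmaVasilevMurashkoGraph σ G).Adj v w) : (sigmaHawkesGraph σ G).Adj v w := by
  obtain ⟨H, -, -, h⟩ := h
  exact sigmaOf_mono (index_blockFitting_dvd hσ v.1 H) h

end Block

/-! ### Towers and acyclic graphs -/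

section Tower

variable {G I : Type*} [Group G]

/-- The primes in the blocks of `S`. -/
def blockPrimes (σ : I → Set ℕ) {n : ℕ} (S : Set (sigmaOf σ n)) : Set ℕ :=
  {p | ∃ v ∈ S, p ∈ σ v.1}

lemma blockPrimes_mono {σ : I → Set ℕ} {n : ℕ} {S T : Set (sigmaOf σ n)} (h : S ⊆ T) :
    blockPrimes σ S ⊆ blockPrimes σ T :=
  fun _ ⟨v, hv, hp⟩ => ⟨v, h hv, hp⟩

lemma finite_sigmaOf {σ : I → Set ℕ} (hσ : IsPrimePartition σ) {n : ℕ} (hn : n ≠ 0) :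
    Finite (sigmaOf σ n) := by
  choose p hpi hp hpn using fun v : sigmaOf σ n => v.2
  refine Finite.of_injective (β := n.primeFactors)
    (fun v => ⟨p v, Nat.mem_primeFactors.2 ⟨hp v, hpn v, hn⟩⟩) fun v w h => ?_
  have h' : p v = p w := congrArg Subtype.val h
  exact Subtype.ext (hσ.eq_of_mem (hpi v) (h' ▸ hpi w))

/-- The vertices of a finite directed graph without circuits can be listed so that every edge
points forward. -/
lemma HasNoCircuits.exists_enumeration {V : Type*} [Finite V] {Γ : Digraph V}
    (h : HasNoCircuits Γ) :
    ∃ (t : ℕ) (e : V ≃ Fin t), ∀ v w, Γ.Adj v w → e v < e w := by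
  let : PartialOrder V :=
    { le := Relation.ReflTransGen Γ.Adj
      le_refl := fun _ => .refl
      le_trans := fun _ _ _ => .trans
      le_antisymm := fun a b hab hba => by
        rcases Relation.reflTransGen_iff_eq_or_transGen.1 hab with h1 | h1
        · exact h1.symm
        · exact absurd (h1.trans_left hba) (h a) }
  have : Finite (LinearExtension V) := ‹Finite V›
  have : Fintype (LinearExtension V) := Fintype.ofFinite _
  let f := Fintype.orderIsoFinOfCardEq (LinearExtension V) rfl
  refine ⟨_, f.symm.toEquiv, fun v w hvw => ?_⟩
  refine lt_of_le_of_ne (f.symm.monotone (toLinearExtension.monotone (.single hvw))) fun heq => ?_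
  obtain rfl : v = w := f.symm.injective heq
  exact h v (.single hvw)

/-- If every set of vertices closed under predecessors in a directed graph on `σ(G)` without
circuits supports a normal Hall subgroup of `G`, the normal Hall subgroups for the initial
segments of a forward listing of the vertices form a tower. -/
lemma hasSigmaTower_of_hasNoCircuits [Finite G] {σ : I → Set ℕ} (hσ : IsPrimePartition σ)
    {Γ : Digraph (sigmaOf σ (Nat.card G))} (hΓ : HasNoCircuits Γ)
    (h : ∀ S : Set (sigmaOf σ (Nat.card G)), (∀ v w, Γ.Adj v w → w ∈ S → v ∈ S) →
      HasNormalHall (blockPrimes σ S) G) : HasSigmaTower σ G := by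
  have := finite_sigmaOf hσ (n := Nat.card G) Nat.card_pos.ne'
  obtain ⟨t, e, he⟩ := hΓ.exists_enumeration
  let S : ℕ → Set (sigmaOf σ (Nat.card G)) := fun k => {v | (e v : ℕ) < k}
  have hS : ∀ k, HasNormalHall (blockPrimes σ (S k)) G := fun k =>
    h _ fun v w hvw hw => show (e v : ℕ) < k from lt_trans (Fin.lt_def.1 (he v w hvw)) hw
  choose N hN hNc hNi using hS
  have hmono : ∀ k l, k ≤ l → N k ≤ N l := fun k l hkl =>
    le_of_isPiNumber ((hNc k).mono (blockPrimes_mono fun v hv => lt_of_lt_of_le hv hkl)) (hNi l)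
  have hmem : ∀ (v : sigmaOf σ (Nat.card G)) k p, p ∈ σ v.1 → p ∈ blockPrimes σ (S k) → e v < k := by
    rintro v k p hp ⟨w, hw, hpw⟩
    rwa [Subtype.ext (hσ.eq_of_mem hp hpw)]
  have hlow : ∀ v : sigmaOf σ (Nat.card G), IsPiNumber (σ v.1)ᶜ (Nat.card (N (e v))) :=
    fun v p hp hpd hpv => lt_irrefl _ (hmem v _ p hpv (hNc _ p hp hpd))
  have hupp : ∀ v : sigmaOf σ (Nat.card G), IsPiNumber (σ v.1)ᶜ (N (e v + 1)).index :=
    fun v p hp hpd hpv => hNi _ p hp hpd ⟨v, Nat.lt_succ_self _, hpv⟩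
  refine ⟨t, fun k => N k, ?_, ?_, ?_, fun k => hN _, ?_⟩
  · refine Subgroup.card_eq_one.1 ((hNc 0).eq_one fun p hp _ => ?_)
    rintro ⟨v, hv, -⟩
    exact Nat.not_lt_zero _ hv
  · refine Subgroup.index_eq_one.1 (((hNi t).eq_one) ?_)
    rw [compl_compl]
    intro p hp hpd
    obtain ⟨i, hi⟩ := hσ.exists_mem hp
    exact ⟨⟨i, p, hi, hp, hpd.trans (Subgroup.index_dvd_card _)⟩, (e _).2, hi⟩
  · rw [Fin.strictMono_iff_lt_succ]
    intro k
    obtain ⟨v, rfl⟩ := e.surjective k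
    refine lt_of_le_of_ne (hmono _ _ (by simp)) fun heq => ?_
    obtain ⟨p, hpv, hp, hpd⟩ := v.2
    have h1 := hlow v
    have h2 := hupp v
    simp only [Fin.val_castSucc, Fin.val_succ] at heq
    rw [← heq] at h2
    rw [← Subgroup.card_mul_index (N (e v))] at hpd
    exact h1.mul h2 p hp hpd hpv
  · intro k
    obtain ⟨v, rfl⟩ := e.surjective k
    refine ⟨v.1, v.2, ?_, hlow v, hupp v⟩
    intro p hp hpd
    simp only [Fin.val_castSucc, Fin.val_succ] at hpd
    obtain ⟨w, hw, hpw⟩ := hNc _ p hp (hpd.trans (Subgroup.relIndex_dvd_card _ _))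
    have h1 := hNi _ p hp (hpd.trans (Subgroup.relIndex_dvd_index_of_normal _ _))
    have h2 : e w = e v := by
      refine Fin.ext (le_antisymm (Nat.lt_succ_iff.1 hw) ?_)
      by_contra hlt
      exact h1 ⟨w, not_le.1 hlt, hpw⟩
    rwa [← e.injective h2]

/-- For a set `S` of vertices closed under predecessors in the `σ`-Hawkes graph and a vertex `j`
outside `S`, the normal `σ j`-complement of `F_{σ j}(G)` has index prime to `S`. The intersection
of all these is a normal Hall subgroup. -/
lemma hasNormalHall_of_sigmaHawkesGraph [Finite G] {σ : I → Set ℕ} (hσ : IsPrimePartition σ)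
    {S : Set (sigmaOf σ (Nat.card G))}
    (hS : ∀ v w, (sigmaHawkesGraph σ G).Adj v w → w ∈ S → v ∈ S) :
    HasNormalHall (blockPrimes σ S) G := by
  obtain ⟨A, hA, hAi, hAle⟩ := exists_least_normal_isPiNumber_index (G := G) (blockPrimes σ S)ᶜ
  refine ⟨A, hA, ?_, hAi⟩
  intro p hp hpd
  obtain ⟨i, hi⟩ := hσ.exists_mem hp
  let v : sigmaOf σ (Nat.card G) := ⟨i, p, hi, hp, hpd.trans (Subgroup.card_subgroup_dvd_card A)⟩
  by_contra hpS
  have hv : v ∉ S := fun hv => hpS ⟨v, hv, hi⟩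
  obtain ⟨L, hL, hLF, h1, h2⟩ :=
    (hasNormalHall_blockFitting (G := G) hσ i).exists_normal (normal_blockFitting hσ i)
  rw [compl_compl] at h2
  have hAL : A ≤ L := by
    refine hAle L hL ?_
    rw [← Subgroup.relIndex_mul_index hLF]
    refine IsPiNumber.mul ?_ ?_
    · rintro q hq hqd ⟨w, hw, hqw⟩
      exact hv (by rwa [show v = w from Subtype.ext (hσ.eq_of_mem (h2 q hq hqd) hqw)])
    · rintro q hq hqd ⟨w, hw, hqw⟩
      exact hv (hS v w ⟨q, hqw, hq, hqd⟩ hw)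
  exact h1 p hp (hpd.trans (Subgroup.card_dvd_of_le hAL)) hi

/-- In a tower, the term `G_k` with `σ i`-factor `G_k/G_{k-1}` lies in `F_{σ i}(G)`, so the edges
of the `σ`-Hawkes graph that start at `i` lead to blocks of later factors. -/
lemma HasSigmaTower.hasNoCircuits [Finite G] {σ : I → Set ℕ} (hσ : IsPrimePartition σ)
    (h : HasSigmaTower σ G) : HasNoCircuits (sigmaHawkesGraph σ G) := by
  obtain ⟨t, N, h0, ht, hmono, hN, hstep⟩ := h
  choose b hb hbrel hblow hbupp using hstep
  have hex : ∀ v : sigmaOf σ (Nat.card G), ∃ k, b k = v.1 := by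
    intro v
    by_contra hcon
    push Not at hcon
    have : ∀ k, IsPiNumber (σ v.1)ᶜ (Nat.card (N k)) := by
      intro k
      induction k using Fin.induction with
      | zero => rw [h0]; simpa using isPiNumber_one _
      | succ k ih =>
        rw [← Subgroup.relIndex_bot_left, ← Subgroup.relIndex_mul_relIndex ⊥ _ _ bot_le
          (hmono k.castSucc_lt_succ).le, Subgroup.relIndex_bot_left]
        exact ih.mul fun p hp hpd hpv => hcon k (hσ.eq_of_mem (hbrel k p hp hpd) hpv)
    have h1 := this (Fin.last t)
    rw [ht, Subgroup.card_top] at h1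
    exact h1.notMem_sigmaOf v.2
  choose pos hpos using hex
  have hedge : ∀ v w, (sigmaHawkesGraph σ G).Adj v w → pos v < pos w := by
    rintro v w ⟨p, hpw, hp, hpd⟩
    have hF : N (pos v).succ ≤ blockFitting σ v.1 G := by
      refine le_blockFitting hσ (hN _) (hasNormalHall_of_relIndex (hN (pos v).castSucc)
        (hmono (pos v).castSucc_lt_succ).le ?_ ?_)
      · rw [← hpos v]; exact hblow _
      · rw [compl_compl]; nth_rw 1 [← hpos v]; exact hbrel _
    have hpd' := hpd.trans (Subgroup.index_dvd_of_le hF)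
    by_contra hlt
    have hle : N (pos w).succ ≤ N (pos v).succ :=
      hmono.monotone (Fin.succ_le_succ_iff.2 (not_lt.1 hlt))
    refine hbupp (pos w) p hp (hpd'.trans (Subgroup.index_dvd_of_le hle)) ?_
    rwa [hpos w]
  have htrans : ∀ v w, Relation.TransGen (sigmaHawkesGraph σ G).Adj v w → pos v < pos w := by
    intro v w hvw
    induction hvw with
    | single h => exact hedge _ _ h
    | tail _ h ih => exact ih.trans (hedge _ _ h)
  exact fun v hv => lt_irrefl _ (htrans v v hv)

/-- A chief factor `H/K` is a section of the first factor `G_k/G_{k-1}` of the tower for which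
`H ⊓ G_k` is not contained in `K`. -/
lemma HasSigmaTower.isSigmaSoluble {σ : I → Set ℕ} (h : HasSigmaTower σ G) :
    IsSigmaSoluble σ G := by
  obtain ⟨t, N, h0, ht, hmono, hN, hstep⟩ := h
  rintro H K ⟨hH, hK, hKH, hchief⟩
  by_contra hcon
  push Not at hcon
  have : ∀ k, H ⊓ N k ≤ K := by
    intro k
    induction k using Fin.induction with
    | zero => simp [h0]
    | succ k ih =>
      have hNk := hN k.succ
      rcases hchief (K ⊔ H ⊓ N k.succ) inferInstance le_sup_left
        (sup_le hKH.le inf_le_left) with h | h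
      · exact sup_eq_left.1 h
      · obtain ⟨i, -, hi, -⟩ := hstep k
        refine absurd (hi.of_dvd ?_) (hcon i)
        have hNk' := hN k.castSucc
        rw [← h, sup_comm, Subgroup.relIndex_sup_right]
        have h1 : (N k.castSucc ⊓ (H ⊓ N k.succ)).relIndex (H ⊓ N k.succ) ∣
            (N k.castSucc).relIndex (N k.succ) := by
          rw [Subgroup.inf_relIndex_right]
          have := Subgroup.relIndex_dvd_index_of_normal ((N k.castSucc).subgroupOf (N k.succ))
            ((H ⊓ N k.succ).subgroupOf (N k.succ))
          rwa [Subgroup.relIndex_subgroupOf inf_le_right] at this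
        refine (Subgroup.relIndex_dvd_of_le_left _ (le_trans ?_ ih)).trans h1
        exact le_inf (inf_le_right.trans inf_le_left) inf_le_left
  exact hKH.not_ge (by simpa [ht] using this (Fin.last t))

end Tower

/-! ### `π`-elements that centralize the `π'`-subgroups they normalize -/

section Action

open scoped Pointwise

variable {G : Type*} [Group G]

/-- For primes `p ∈ π` and `q ∉ π`, every `p`-element of `G` that normalizes a `q`-subgroup
centralizes it. -/
def PiElementsCentralize (π : Set ℕ) (G : Type*) [Group G] : Prop :=
  ∀ p q : ℕ, p.Prime → q.Prime → p ∈ π → q ∉ π → ∀ (Q : Subgroup G) (x : G), IsPGroup q Q →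
    (∃ n, x ^ p ^ n = 1) → x ∈ Subgroup.normalizer (Q : Set G) →
    x ∈ Subgroup.centralizer (Q : Set G)

/-- If `f n` is a `p`-element, a suitable power of `n` is a `p`-element with the same image. -/
lemma exists_pow_isPElement_map_eq [Finite G] {G' : Type*} [Group G'] (f : G →* G') {p : ℕ}
    (hp : p.Prime) {n : G} (h : ∃ a, f n ^ p ^ a = 1) :
    ∃ k : ℕ, (∃ b, (n ^ k) ^ p ^ b = 1) ∧ f (n ^ k) = f n := by
  obtain ⟨a, ha⟩ := h
  obtain ⟨b, m, hpm, hm⟩ := Nat.exists_eq_pow_mul_and_not_dvd (orderOf_pos n).ne' p hp.ne_one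
  have hco : Nat.Coprime m (orderOf (f n)) :=
    Nat.Coprime.coprime_dvd_right (orderOf_dvd_of_pow_eq_one ha)
      (((Nat.Prime.coprime_iff_not_dvd hp).2 hpm).symm.pow_right a)
  obtain ⟨c, hc⟩ := exists_pow_eq_self_of_coprime hco
  refine ⟨m * c, ⟨b, ?_⟩, by rw [map_pow, pow_mul, hc]⟩
  rw [← pow_mul, mul_right_comm, mul_comm m, ← hm, pow_mul, pow_orderOf_eq_one, one_pow]

/-- If an automorphism of `Y` induced by conjugation with `x` fixes the subgroup `P` of `Y`, then
`x` normalizes `P`. -/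
lemma mem_normalizer_map_subtype {Y : Subgroup G} {φ : MulAut Y} {x : G}
    (hφ : ∀ y : Y, (φ y : G) = x * y * x⁻¹) {P : Subgroup Y} (h : φ • P = P) :
    x ∈ Subgroup.normalizer (P.map Y.subtype : Set G) := by
  rw [Subgroup.mem_normalizer_iff]
  refine fun g => ⟨?_, ?_⟩
  · rintro ⟨y, hy, rfl⟩
    refine ⟨φ y, ?_, hφ y⟩
    exact h ▸ Subgroup.smul_mem_pointwise_smul y φ P hy
  · rintro ⟨y, hy, hyg⟩
    have hy' : y ∈ φ • P := h.symm ▸ hy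
    obtain ⟨z, hz, rfl⟩ := hy'
    refine ⟨z, hz, ?_⟩
    have h1 : x * (z : G) * x⁻¹ = x * g * x⁻¹ := (hφ z).symm.trans hyg
    exact mul_left_cancel (mul_right_cancel h1)

/-- The property passes to quotients. A `p`-element that normalizes a `q`-subgroup of `G ⧸ K`
lifts, by the Frattini argument in the preimage `Y` of this subgroup, to a `p`-element that
normalizes a Sylow `q`-subgroup of `Y`. -/
lemma PiElementsCentralize.quotient [Finite G] {π : Set ℕ} (h : PiElementsCentralize π G)
    (K : Subgroup G) [K.Normal] : PiElementsCentralize π (G ⧸ K) := by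
  intro p q hp hq hpπ hqπ Q xb hQ hx hxn
  have : Fact q.Prime := ⟨hq⟩
  obtain ⟨x, rfl⟩ := QuotientGroup.mk'_surjective K xb
  set f := QuotientGroup.mk' K with hf
  set Y := Q.comap f with hY
  have hxY : x ∈ Subgroup.normalizer (Y : Set G) := by
    rw [Subgroup.mem_normalizer_iff] at hxn ⊢
    intro y
    simpa [hY] using hxn (f y)
  obtain ⟨P⟩ : Nonempty (Sylow q Y) := inferInstance
  have hsurj := f.subgroupComap_surjective_of_surjective Q (QuotientGroup.mk'_surjective K)
  have htop : ∀ z ∈ Q, ∃ u : Y, u ∈ P ∧ f u = z := by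
    intro z hz
    have h1 : (P.mapSurjective hsurj : Subgroup Q) = ⊤ :=
      ((P.mapSurjective hsurj).is_maximal' (hQ.to_subgroup ⊤) le_top).symm
    have h2 : (⟨z, hz⟩ : Q) ∈ (P.mapSurjective hsurj : Subgroup Q) := h1 ▸ Subgroup.mem_top _
    obtain ⟨u, hu, huz⟩ := h2
    exact ⟨u, hu, congrArg Subtype.val huz⟩
  let φ : MulAut Y := Y.normalizerMonoidHom ⟨x, hxY⟩
  obtain ⟨y, hy⟩ := MulAction.exists_smul_eq Y P (φ • P)
  obtain ⟨u, hu, huy⟩ := htop (f y) y.2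
  -- `y⁻¹ * x` normalizes `P`, and multiplying by `u ∈ P` makes it a lift of `f x`
  have hyx : (y⁻¹ : G) * x ∈ Subgroup.normalizer ((P : Subgroup Y).map Y.subtype : Set G) := by
    refine mem_normalizer_map_subtype (φ := (MulAut.conj y)⁻¹ * φ) (fun z => ?_) ?_
    · change ((y⁻¹ * φ z * y : Y) : G) = _
      have : (φ z : G) = x * z * x⁻¹ := rfl
      simp [this, mul_assoc]
    · rw [mul_smul, inv_smul_eq_iff]
      exact (congrArg Sylow.toSubgroup hy).symm
  have hu' : (u : G) ∈ (P : Subgroup Y).map Y.subtype := ⟨u, hu, rfl⟩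
  have hn := mul_mem (Subgroup.le_normalizer hu') hyx
  have hfn : f (u * ((y⁻¹ : G) * x)) = f x := by
    rw [map_mul, map_mul, huy, map_inv, mul_inv_cancel_left]
  obtain ⟨k, hk, hfk⟩ := exists_pow_isPElement_map_eq f hp (n := u * ((y⁻¹ : G) * x))
    (by rwa [hfn])
  have hcen := h p q hp hq hpπ hqπ _ _ (P.isPGroup'.map _) hk (pow_mem hn k)
  intro z hz
  obtain ⟨w, hw, rfl⟩ := htop z hz
  rw [← hfn, ← hfk, ← map_mul, ← map_mul, hcen w ⟨w, hw, rfl⟩]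

/-- A normal `π'`-subgroup `M` is centralized by all `p`-elements `x` with `p ∈ π`: for each `q`
the element `x` normalizes a Sylow `q`-subgroup of `M`, because their number is prime to `p`. -/
lemma PiElementsCentralize.mem_centralizer [Finite G] {π : Set ℕ} (h : PiElementsCentralize π G)
    {M : Subgroup G} [hM : M.Normal] (hMπ : IsPiNumber πᶜ (Nat.card M)) {p : ℕ} (hp : p.Prime)
    (hpπ : p ∈ π) {x : G} (hx : ∃ n, x ^ p ^ n = 1) : x ∈ Subgroup.centralizer (M : Set G) := by
  let D := (Subgroup.centralizer {x}).subgroupOf M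
  have hD : D = ⊤ := by
    rw [← Subgroup.index_eq_one]
    by_contra hne
    obtain ⟨q, hq, hqD⟩ := Nat.exists_prime_and_dvd hne
    have hqM : q ∣ Nat.card M := hqD.trans (Subgroup.index_dvd_card D)
    have : Fact q.Prime := ⟨hq⟩
    have : Fact p.Prime := ⟨hp⟩
    let φ : MulAut M := MulAut.conjNormal x
    have hZ : IsPGroup p (Subgroup.zpowers φ) := by
      obtain ⟨n, hn⟩ := hx
      have hφ : orderOf φ ∣ p ^ n := orderOf_dvd_of_pow_eq_one (by rw [← map_pow, hn, map_one])
      obtain ⟨k, -, hk⟩ := (Nat.dvd_prime_pow hp).1 hφ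
      exact IsPGroup.of_card (by rw [Nat.card_zpowers, hk])
    obtain ⟨P, hP⟩ := hZ.nonempty_fixed_point_of_prime_not_dvd_card (Sylow q M) fun hd =>
      hMπ p hp (hd.trans ((Nonempty.some inferInstance : Sylow q M).card_dvd_index.trans
        (Subgroup.index_dvd_card _))) hpπ
    have hφP : φ • P = P := hP ⟨φ, Subgroup.mem_zpowers φ⟩
    have hnorm : x ∈ Subgroup.normalizer ((P : Subgroup M).map M.subtype : Set G) :=
      mem_normalizer_map_subtype (φ := φ) (fun _ => rfl) (congrArg Sylow.toSubgroup hφP)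
    have hcen := h p q hp hq hpπ (hMπ q hq hqM) _ x (P.isPGroup'.map _) hx hnorm
    have hPD : (P : Subgroup M) ≤ D := by
      intro y hy
      have := hcen y ⟨y, hy, rfl⟩
      simpa [D, Subgroup.mem_subgroupOf, Subgroup.mem_centralizer_singleton_iff] using this
    exact P.not_dvd_index (hqD.trans (Subgroup.index_dvd_of_le hPD))
  intro m hm
  have : (⟨m, hm⟩ : M) ∈ D := hD ▸ Subgroup.mem_top _
  simpa [D, Subgroup.mem_subgroupOf, Subgroup.mem_centralizer_singleton_iff] using this

/-- Let `P` be a maximal normal `π`-subgroup, `M/P` a maximal normal `π'`-subgroup of `G/P`, and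
`N/M` a chief factor, necessarily a `π`-group. The `π`-elements of `N/P` centralize `M/P`, so the
centralizer of `M/P` in `N/P` has a nontrivial normal Hall `π`-subgroup, against the choice of
`P`. Hence `M = G`. -/
lemma PiElementsCentralize.hasNormalHall [Finite G] {π : Set ℕ} (h : PiElementsCentralize π G)
    (hchief : ∀ H K : Subgroup G, IsChiefFactor H K →
      IsPiNumber π (K.relIndex H) ∨ IsPiNumber πᶜ (K.relIndex H)) : HasNormalHall π G := by
  obtain ⟨P, hP⟩ := (Set.toFinite {P : Subgroup G | P.Normal ∧ IsPiNumber π (Nat.card P)})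
    |>.exists_maximal ⟨⊥, inferInstance, by simpa using isPiNumber_one _⟩
  obtain ⟨⟨hPn, hPc⟩, -⟩ := id hP
  obtain ⟨M, hM⟩ := (Set.toFinite {M : Subgroup G | M.Normal ∧ P ≤ M ∧
    IsPiNumber πᶜ (P.relIndex M)}).exists_maximal
      ⟨P, hPn, le_rfl, by simpa using isPiNumber_one _⟩
  obtain ⟨⟨hMn, hPM, hMi⟩, -⟩ := id hM
  rcases eq_or_ne M ⊤ with rfl | hMtop
  · exact ⟨P, hPn, hPc, by simpa using hMi⟩
  exfalso
  obtain ⟨N, hNM⟩ := exists_isChiefFactor_bot hMn hMtop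
  obtain ⟨hNn, -, hlt, -⟩ := id hNM
  have hNMi : IsPiNumber π (M.relIndex N) := by
    refine (hchief N M hNM).resolve_right fun h' => hlt.not_ge ?_
    refine hM.le_of_ge ⟨hNn, hPM.trans hlt.le, ?_⟩ hlt.le
    rw [← Subgroup.relIndex_mul_relIndex P M N hPM hlt.le]
    exact hMi.mul h'
  have hsurj := QuotientGroup.mk'_surjective P
  have hker := QuotientGroup.ker_mk' P
  set f := QuotientGroup.mk' P
  have hMbn : (M.map f).Normal := hMn.map _ hsurj
  have hNbn : (N.map f).Normal := hNn.map _ hsurj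
  have hMbc : IsPiNumber πᶜ (Nat.card (M.map f)) := by
    rwa [← Subgroup.relIndex_ker, hker]
  have hMbNb : (M.map f).relIndex (N.map f) = M.relIndex N := by
    rw [Subgroup.relIndex_map_map, hker, sup_eq_left.2 hPM, sup_eq_left.2 (hPM.trans hlt.le)]
  let C := Subgroup.centralizer (M.map f : Set (G ⧸ P))
  have hMC : IsPiNumber πᶜ (Nat.card (M.map f ⊓ C : Subgroup (G ⧸ P))) :=
    hMbc.of_dvd (Subgroup.card_dvd_of_le inf_le_left)
  have hinf : M.map f ⊓ C = M.map f ⊓ (N.map f ⊓ C) := by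
    rw [← inf_assoc, inf_eq_left.2 (Subgroup.map_mono hlt.le)]
  have hACi : IsPiNumber π ((M.map f ⊓ C).relIndex (N.map f ⊓ C)) := by
    rw [hinf, Subgroup.inf_relIndex_right]
    refine IsPiNumber.of_dvd (hMbNb ▸ hNMi) ?_
    have := Subgroup.relIndex_dvd_index_of_normal ((M.map f).subgroupOf (N.map f))
      ((N.map f ⊓ C).subgroupOf (N.map f))
    rwa [Subgroup.relIndex_subgroupOf inf_le_left] at this
  obtain ⟨L, hLn, -, hLc, -⟩ := exists_normal_complement_of_central
    (H := M.map f ⊓ C) (A := N.map f ⊓ C) inferInstance inferInstance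
    (inf_le_inf_right _ (Subgroup.map_mono hlt.le))
    (inf_le_right.trans (Subgroup.centralizer_le inf_le_left))
    (hACi.coprime hMC).symm
  have hPL : P ≤ L.comap f := hker.symm.le.trans (Subgroup.ker_le_comap f L)
  have hLP : L.comap f ≤ P := by
    refine hP.le_of_ge ⟨inferInstance, ?_⟩ hPL
    rw [← Subgroup.relIndex_bot_left, ← Subgroup.relIndex_mul_relIndex ⊥ P _ bot_le hPL,
      Subgroup.relIndex_bot_left]
    have h1 := Subgroup.relIndex_ker (L.comap f) f
    rw [Subgroup.map_comap_eq_self_of_surjective hsurj, hker, hLc] at h1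
    exact hPc.mul (h1 ▸ hACi)
  have hLbot : Nat.card L = 1 := by
    rw [← Subgroup.map_comap_eq_self_of_surjective hsurj L, ← Subgroup.relIndex_ker, hker,
      Subgroup.relIndex_eq_one]
    exact hLP
  have hle : N.map f ⊓ C ≤ M.map f := by
    rw [hLc, Subgroup.relIndex_eq_one] at hLbot
    exact hLbot.trans inf_le_left
  have hne : M.relIndex N ≠ 1 := fun h => hlt.not_ge (Subgroup.relIndex_eq_one.1 h)
  obtain ⟨p, hp, hpd⟩ := Nat.exists_prime_and_dvd hne
  have hpπ := hNMi p hp hpd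
  have : Fact p.Prime := ⟨hp⟩
  obtain ⟨x, hx⟩ := exists_prime_orderOf_dvd_card' (G := N.map f) p
    ((hMbNb ▸ hpd).trans (Subgroup.relIndex_dvd_card _ _))
  have hxp : (x : G ⧸ P) ^ p ^ 1 = 1 := by
    rw [pow_one, ← hx, ← Subgroup.coe_pow, pow_orderOf_eq_one, Subgroup.coe_one]
  have hxM := hle ⟨x.2, (h.quotient P).mem_centralizer hMbc hp hpπ ⟨1, hxp⟩⟩
  refine hMbc p hp ?_ hpπ
  rw [← hx, ← Subgroup.orderOf_coe]
  exact Subgroup.orderOf_dvd_natCard _ hxM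

end Action

/-! ### Critical subgroups -/

section Critical

variable {G I : Type*} [Group G]

lemma hasNormalHall_of_isPiNumber_card {π : Set ℕ} (h : IsPiNumber π (Nat.card G)) :
    HasNormalHall π G :=
  ⟨⊤, inferInstance, by rwa [Subgroup.card_top], by simpa using isPiNumber_one _⟩

lemma IsSigmaNilpotent.of_mulEquiv [Finite G] {σ : I → Set ℕ} (hσ : IsPrimePartition σ)
    {G' : Type*} [Group G'] [Finite G'] (e : G ≃* G') (h : IsSigmaNilpotent σ G) :
    IsSigmaNilpotent σ G' :=
  (isSigmaNilpotent_iff hσ).2 fun i => ((isSigmaNilpotent_iff hσ).1 h i).of_mulEquiv e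

/-- A subgroup that is not `σ`-nilpotent contains an `𝔑_σ`-critical one. -/
lemma exists_isSigmaCritical_le [Finite G] {σ : I → Set ℕ} (hσ : IsPrimePartition σ)
    {X : Subgroup G} (hX : ¬ IsSigmaNilpotent σ X) : ∃ H ≤ X, IsSigmaCritical σ H := by
  obtain ⟨H, hH⟩ := (Set.toFinite {H : Subgroup G | H ≤ X ∧ ¬ IsSigmaNilpotent σ H})
    |>.exists_minimal ⟨X, le_rfl, hX⟩
  refine ⟨H, hH.prop.1, hH.prop.2, fun L hL => ?_⟩
  by_contra hcon
  have hle : L.map H.subtype ≤ H := Subgroup.map_subtype_le L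
  have h1 : H ≤ L.map H.subtype := hH.le_of_le ⟨hle.trans hH.prop.1, fun hnil =>
    hcon (hnil.of_mulEquiv hσ (L.equivMapOfInjective _ H.subtype_injective).symm)⟩ hle
  refine hL.not_ge fun x _ => ?_
  obtain ⟨y, hy, hyx⟩ := h1 x.2
  rwa [← Subtype.ext hyx]

/-- In particular, a `p`-element that normalizes `Q` generates with `Q` a group in which `Q` has
`p`-power index. -/
lemma relIndex_sup_zpowers_dvd {Q : Subgroup G} {x : G} {m : ℕ} (hx : x ^ m = 1)
    (hxn : x ∈ Subgroup.normalizer (Q : Set G)) :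
    Q.relIndex (Q ⊔ Subgroup.zpowers x) ∣ m := by
  have hQN : Q ≤ Subgroup.normalizer (Q : Set G) := Subgroup.le_normalizer
  have hxN : Subgroup.zpowers x ≤ Subgroup.normalizer (Q : Set G) := by
    rwa [Subgroup.zpowers_le]
  rw [← Subgroup.relIndex_subgroupOf (sup_le hQN hxN), Subgroup.subgroupOf_sup hQN hxN, sup_comm,
    Subgroup.relIndex_sup_right, Subgroup.relIndex_subgroupOf hxN]
  refine (Subgroup.relIndex_dvd_card _ _).trans ?_
  rw [Nat.card_zpowers]
  exact orderOf_dvd_of_pow_eq_one hx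

/-- Let `S` be closed under predecessors in the `σ`-Vasil'ev–Murashko graph. If a `p`-element `x`,
with `p` in a block `i ∈ S`, normalized a `q`-subgroup `Q`, with `q` in a block `j ∉ S`, without
centralizing it, then a critical subgroup of `Q ⟨x⟩` would have a normal Sylow `q`-subgroup and
no normal `σ j`-complement, so that it would give an edge from `j` to `i`. -/
lemma piElementsCentralize_of_sigmaVasilevMurashkoGraph [Finite G] {σ : I → Set ℕ}
    (hσ : IsPrimePartition σ) {S : Set (sigmaOf σ (Nat.card G))}
    (hS : ∀ v w, (sigmaVasilevMurashkoGraph σ G).Adj v w → w ∈ S → v ∈ S) :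
    PiElementsCentralize (blockPrimes σ S) G := by
  rintro p q hp hq ⟨w, hwS, hpw⟩ hqπ Q x hQ ⟨n, hx⟩ hxn
  have : Fact q.Prime := ⟨hq⟩
  by_contra hcen
  obtain ⟨j, hqj⟩ := hσ.exists_mem hq
  have hpj : p ∉ σ j := fun hpj => hqπ ⟨w, hwS, hσ.eq_of_mem hpw hpj ▸ hqj⟩
  have hqw : q ∉ σ w.1 := fun hqw => hqπ ⟨w, hwS, hqw⟩
  obtain ⟨a, ha⟩ := IsPGroup.iff_card.1 hQ
  set X := Q ⊔ Subgroup.zpowers x with hXdef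
  have hQX : Q ≤ X := le_sup_left
  have hxX : x ∈ X := le_sup_right (a := Q) (Subgroup.mem_zpowers x)
  have hXN : X ≤ Subgroup.normalizer (Q : Set G) :=
    sup_le Subgroup.le_normalizer (by rwa [Subgroup.zpowers_le])
  have hX : ¬ IsSigmaNilpotent σ X := by
    intro hnil
    obtain ⟨M, hM, hMc, hMi⟩ := (isSigmaNilpotent_iff hσ).1 hnil j
    have hxM : (⟨x, hxX⟩ : X) ∈ M := by
      refine mem_of_isPiNumber_orderOf hMi ?_
      rw [Subgroup.orderOf_mk]
      exact (isPiNumber_prime_pow hp hpj n).of_dvd (orderOf_dvd_of_pow_eq_one hx)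
    refine hcen fun y hy => ?_
    -- the commutator of `x` and `y` lies both in `M` and in `Q`
    have h1 : (⟨x, hxX⟩ * (⟨y, hQX hy⟩ * ⟨x, hxX⟩⁻¹ * ⟨y, hQX hy⟩⁻¹) : X) ∈ M :=
      M.mul_mem hxM (hM.conj_mem _ (M.inv_mem hxM) _)
    have h2 : x * y * x⁻¹ * y⁻¹ ∈ Q :=
      Q.mul_mem ((Subgroup.mem_normalizer_iff.1 hxn y).1 hy) (Q.inv_mem hy)
    have h3 : IsPiNumber (σ j) (orderOf (x * y * x⁻¹ * y⁻¹)) :=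
      isPiNumber_orderOf_of_mem (by rw [ha]; exact isPiNumber_prime_pow hq hqj a) h2
    have h4 : IsPiNumber (σ j)ᶜ (orderOf (x * y * x⁻¹ * y⁻¹)) := by
      have := isPiNumber_orderOf_of_mem hMc h1
      rw [← Subgroup.orderOf_coe] at this
      simpa [mul_assoc] using this
    have h5 := orderOf_eq_one_iff.1 (h3.eq_one h4)
    rw [mul_inv_eq_one, mul_inv_eq_iff_eq_mul] at h5
    exact h5.symm
  obtain ⟨H, hHX, hH⟩ := exists_isSigmaCritical_le hσ hX
  have hQn : (Q.subgroupOf H).Normal :=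
    Subgroup.normal_subgroupOf_of_le_normalizer (hHX.trans hXN)
  have hQc : ∀ π : Set ℕ, q ∈ π → IsPiNumber π (Nat.card (Q.subgroupOf H)) := fun π hqπ =>
    (isPiNumber_prime_pow hq hqπ a).of_dvd
      (ha ▸ Subgroup.card_comap_dvd_of_injective Q H.subtype H.subtype_injective)
  have hQi : ∀ π : Set ℕ, p ∈ π → IsPiNumber π (Q.subgroupOf H).index := fun π hpπ => by
    refine (isPiNumber_prime_pow hp hpπ n).of_dvd (dvd_trans ?_ (relIndex_sup_zpowers_dvd hx hxn))
    have : (Q.subgroupOf X).Normal := Subgroup.normal_subgroupOf_of_le_normalizer hXN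
    have := Subgroup.relIndex_dvd_index_of_normal (Q.subgroupOf X) (H.subgroupOf X)
    rwa [Subgroup.relIndex_subgroupOf hHX] at this
  have hHc := Subgroup.card_mul_index (Q.subgroupOf H)
  have hHj : ¬ HasNormalHall (σ j)ᶜ H := by
    intro hHj
    refine hH.1 ((isSigmaNilpotent_iff hσ).2 fun k => ?_)
    rcases eq_or_ne k j with rfl | hkj
    · exact hHj
    have hqk : q ∈ (σ k)ᶜ := fun hqk => hkj (hσ.eq_of_mem hqk hqj)
    by_cases hpk : p ∈ σ k
    · exact ⟨_, hQn, hQc _ hqk, hQi _ (by rwa [compl_compl])⟩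
    · exact hasNormalHall_of_isPiNumber_card (hHc ▸ (hQc _ hqk).mul (hQi _ hpk))
  have hjH : j ∈ sigmaOf σ (Nat.card H) := by
    by_contra hcon
    exact hHj (hasNormalHall_of_isPiNumber_card (isPiNumber_compl_of_notMem hcon))
  have hQF : Q.subgroupOf H ≤ blockFitting σ j H := by
    refine le_blockFitting hσ hQn (hasNormalHall_of_relIndex Subgroup.normal_bot bot_le ?_ ?_)
    · simpa using isPiNumber_one _
    · rw [Subgroup.relIndex_bot_left, compl_compl]
      exact hQc _ hqj
  refine hqπ ⟨⟨j, sigmaOf_mono (Subgroup.card_subgroup_dvd_card H) hjH⟩,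
    hS _ w ⟨H, hH, hjH, ?_⟩ hwS, hqj⟩
  by_contra hcon
  have h1 := ((hQi _ hpw).of_dvd (Subgroup.index_dvd_of_le hQF)).eq_one
    (isPiNumber_compl_of_notMem hcon)
  have h2 := hasNormalHall_blockFitting (G := H) hσ j
  rw [Subgroup.index_eq_one.1 h1] at h2
  exact hHj (h2.of_mulEquiv Subgroup.topEquiv)

/-- In a `σ`-soluble group, a set of vertices closed under predecessors in the
`σ`-Vasil'ev–Murashko graph supports a normal Hall subgroup. -/
lemma hasNormalHall_of_sigmaVasilevMurashkoGraph [Finite G] {σ : I → Set ℕ}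
    (hσ : IsPrimePartition σ) (hG : IsSigmaSoluble σ G) {S : Set (sigmaOf σ (Nat.card G))}
    (hS : ∀ v w, (sigmaVasilevMurashkoGraph σ G).Adj v w → w ∈ S → v ∈ S) :
    HasNormalHall (blockPrimes σ S) G := by
  refine (piElementsCentralize_of_sigmaVasilevMurashkoGraph hσ hS).hasNormalHall fun H K hHK => ?_
  obtain ⟨i, hi⟩ := hG H K hHK
  by_cases h : ∃ v ∈ S, v.1 = i
  · obtain ⟨v, hv, rfl⟩ := h
    exact .inl (hi.mono fun p hp => ⟨v, hv, hp⟩)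
  · refine .inr (hi.mono ?_)
    rintro p hp ⟨v, hv, hpv⟩
    exact h ⟨v, hv, hσ.eq_of_mem hpv hp⟩

end Critical

theorem theorem1p4 {I : Type*} (σ : I → Set ℕ) (hσ : IsPrimePartition σ)
    (G : Type*) [Group G] [Finite G] [Nontrivial G] :
    List.TFAE [
      HasSigmaTower σ G,
      HasNoCircuits (sigmaHawkesGraph σ G),
      IsSigmaSoluble σ G ∧ HasNoCircuits (sigmaVasilevMurashkoGraph σ G)] := by
  tfae_have 1 → 2 := fun h => h.hasNoCircuits hσ
  tfae_have 2 → 1 := fun h =>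
    hasSigmaTower_of_hasNoCircuits hσ h fun _ hS => hasNormalHall_of_sigmaHawkesGraph hσ hS
  tfae_have 1 → 3 := fun h => ⟨h.isSigmaSoluble, fun v hv => h.hasNoCircuits hσ v
    (Relation.TransGen.mono
      (fun _ _ => sigmaHawkesGraph_adj_of_sigmaVasilevMurashkoGraph_adj hσ) v v hv)⟩
  tfae_have 3 → 1 := fun h =>
    hasSigmaTower_of_hasNoCircuits hσ h.2 fun _ hS =>
      hasNormalHall_of_sigmaVasilevMurashkoGraph hσ h.1 hS
  tfae_finish
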